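/- For $q\in\mathbb C$ and an integer $N\ge 1$ put $(q)_N:=\prod_{j=1}^{N}(1-q^j)$. Let $\mathrm{Li}_s(w):=\sum_{n=1}^\infty w^n/n^s$ denote the polylogarithm (for $|w|<1$, and for $|w|\le 1$ when $\Re(s)>1$), let $B_n$ be the Bernoulli numbers, let $\delta_{i,j}$ be the Kronecker delta, and set $$p(z):=\frac{\mathrm{Li}_2(e^{z})-\mathrm{Li}_2(1)}{z},\qquad f_\ell(z):=\delta_{1,\ell}\,\frac{z}{24}+\frac{B_{\ell+1}}{(\ell+1)!}\,z^\ell\,\mathrm{Li}_{1-\ell}(e^{z})\qquad(\ell\in\mathbb Z_{\ge 1}).$$ **Theorem 2.1.** Let $L\ge 1$ be an integer, let $\delta>0$ and let $C$ be a real number. There is a constant $K$, depending only on $L$, $\delta$ and $C$, such that for every integer $N\ge 1$ and every $z\in\mathbb C$ with $\Re(z)\le-\delta<0$ and $|z|\le C$, $$\frac{1}{(e^{z/N})_N}=\left(\frac{-z}{2\pi N(1-e^{z})}\right)^{1/2}\exp\left(N\,p(z)+\sum_{\ell=1}^{L-1}\frac{f_\ell(z)}{N^{\ell}}+E\right)$$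 for some $E=E(z,N)\in\mathbb C$ with $|E|\le K N^{-L}$. Here the square root is the principal one. -/

import Mathlib

namespace RestrictedProduct

noncomputable section

/-- The product `(q)_N = (1 - q)(1 - q^2) ⋯ (1 - q^N)`. -/
def qProd (q : ℂ) (N : ℕ) : ℂ :=
  ∏ j ∈ Finset.Icc 1 N, (1 - q ^ j)

/-- The polylogarithm `Li_s(w) = ∑_{n ≥ 1} w^n / n^s` of complex order `s`, for `|w| < 1`
(and also for `|w| ≤ 1` when `Re s > 1`); the summation variable below is `n - 1`. -/
def polylog (s w : ℂ) : ℂ :=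
  ∑' n : ℕ, w ^ (n + 1) / ((n + 1 : ℕ) : ℂ) ^ s

/-- `p(z) = (Li_2(e^z) - Li_2(1)) / z`. -/
def p (z : ℂ) : ℂ :=
  (polylog 2 (Complex.exp z) - polylog 2 1) / z

/-- `f_ℓ(z) = δ_{1,ℓ} z / 24 + (B_{ℓ+1} / (ℓ+1)!) z^ℓ Li_{1-ℓ}(e^z)`, for `ℓ ≥ 1`. -/
def f (l : ℕ) (z : ℂ) : ℂ :=
  (if l = 1 then z / 24 else 0) +
    ((bernoulli (l + 1) : ℚ) : ℂ) / ((l + 1).factorial : ℂ) * z ^ l *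
      polylog (1 - (l : ℂ)) (Complex.exp z)

end

end RestrictedProduct

/-! Put `h = z / N` and `q = exp h`, so that `q ^ N = exp z`. Then `qProd q N` is the quotient of `∏
(1 - q ^ n)` by `∏ (1 - exp z * q ^ n)`, and the two infinite products are treated separately. Eta
inversion turns the numerator into a square root, the factor `exp (π² / (6 h) - h / 24)` and a
product in the dual nome `exp (4 π² / h)`, which is exponentially close to `1`
(`tprod_one_sub_exp_pow_inversion`, `exists_tprod_one_sub_pow_eq_exp`). The logarithm of the
denominator is a Lambert series with factors `1 / (exp y - 1)`, `y = -m h`. All these `y` lie in one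
cone around the positive axis, where the Bernoulli expansion is uniform; summing it over `m`
produces the polylogarithms (`exists_norm_lambert_sub_sum_polylog_le`). The `π² / (6 h)` terms
cancel. -/

open Complex

/-! ### Bernoulli expansion of `1 / (exp y - 1)` -/

/-- The truncated Bernoulli generating function inverts `exp y - 1` up to order `L + 2`. -/
theorem exists_norm_sum_bernoulli_mul_exp_sub_one_sub_le (L : ℕ) :
    ∃ K : ℝ, ∀ y : ℂ, ‖y‖ ≤ 1 →
      ‖(∑ k ∈ Finset.range (L + 1), ((bernoulli k : ℚ) : ℂ) / (k.factorial : ℂ) * y ^ k) *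
        (exp y - 1) - y‖ ≤ K * ‖y‖ ^ (L + 2) := by
  set T : Polynomial ℂ := PowerSeries.trunc (L + 1) (bernoulliPowerSeries ℂ) with hT
  set Ex : Polynomial ℂ := PowerSeries.trunc (L + 2) (PowerSeries.exp ℂ) with hEx
  have hTe (y : ℂ) : T.eval y =
      ∑ k ∈ Finset.range (L + 1), ((bernoulli k : ℚ) : ℂ) / (k.factorial : ℂ) * y ^ k := by
    rw [hT, Polynomial.eval, PowerSeries.eval₂_trunc_eq_sum_range]
    refine Finset.sum_congr rfl fun k _ ↦ ?_
    simp [bernoulliPowerSeries]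
  have hEe (y : ℂ) : Ex.eval y = ∑ k ∈ Finset.range (L + 2), y ^ k / (k.factorial : ℂ) := by
    rw [hEx, Polynomial.eval, PowerSeries.eval₂_trunc_eq_sum_range]
    refine Finset.sum_congr rfl fun k _ ↦ ?_
    simp [PowerSeries.coeff_exp]
    ring
  have trunc_sub (n : ℕ) (F : PowerSeries ℂ) :
      ∃ R : PowerSeries ℂ, ((PowerSeries.trunc n F : Polynomial ℂ) : PowerSeries ℂ) =
        F - PowerSeries.X ^ n * R := by
    have : PowerSeries.X ^ n ∣
        F - ((PowerSeries.trunc n F : Polynomial ℂ) : PowerSeries ℂ) := by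
      rw [PowerSeries.X_pow_dvd_iff]
      intro m hm
      simp [PowerSeries.coeff_trunc, hm]
    obtain ⟨R, hR⟩ := this
    exact ⟨R, by rw [← hR]; ring⟩
  obtain ⟨R₁, hR₁⟩ := trunc_sub (L + 1) (bernoulliPowerSeries ℂ)
  obtain ⟨R₂, hR₂⟩ := trunc_sub (L + 2) (PowerSeries.exp ℂ)
  obtain ⟨R₃, hR₃⟩ : PowerSeries.X ∣ PowerSeries.exp ℂ - 1 := by
    rw [PowerSeries.X_dvd_iff]; simp
  -- Truncating the Bernoulli series at order `L + 1` suffices: its tail is multiplied by `exp - 1`,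
  -- which supplies one more factor `X`.
  have hdvd : (Polynomial.X : Polynomial ℂ) ^ (L + 2) ∣ T * (Ex - 1) - Polynomial.X := by
    rw [Polynomial.X_pow_dvd_iff]
    intro m hm
    rw [← Polynomial.coeff_coe]
    have : ((T * (Ex - 1) - Polynomial.X : Polynomial ℂ) : PowerSeries ℂ) =
        PowerSeries.X ^ (L + 2) * (-R₁ * R₃ - (T : PowerSeries ℂ) * R₂) := by
      push_cast
      linear_combination (T : PowerSeries ℂ) * hR₂ + (PowerSeries.exp ℂ - 1) * hR₁ +
        bernoulliPowerSeries_mul_exp_sub_one ℂ - PowerSeries.X ^ (L + 1) * R₁ * hR₃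
    rw [this]
    exact (PowerSeries.X_pow_dvd_iff.1 (Dvd.intro _ rfl)) m hm
  obtain ⟨Q, hQ⟩ := hdvd
  obtain ⟨K₁, hK₁⟩ := (isCompact_closedBall (0 : ℂ) 1).exists_bound_of_continuousOn
    Q.continuous.continuousOn
  obtain ⟨K₂, hK₂⟩ := (isCompact_closedBall (0 : ℂ) 1).exists_bound_of_continuousOn
    T.continuous.continuousOn
  obtain ⟨K₃, hK₃⟩ : ∃ K₃ : ℝ, ∀ y : ℂ, ‖y‖ ≤ 1 → ‖exp y - Ex.eval y‖ ≤ ‖y‖ ^ (L + 2) * K₃ :=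
    ⟨_, fun y hy ↦ by rw [hEe]; exact Complex.exp_bound hy (Nat.succ_pos _)⟩
  refine ⟨K₁ + K₂ * K₃, fun y hy ↦ ?_⟩
  have hmem : y ∈ Metric.closedBall (0 : ℂ) 1 := by simpa using hy
  have key : T.eval y * (exp y - 1) - y =
      y ^ (L + 2) * Q.eval y + T.eval y * (exp y - Ex.eval y) := by
    have := congrArg (Polynomial.eval y) hQ
    simp only [Polynomial.eval_sub, Polynomial.eval_mul, Polynomial.eval_one, Polynomial.eval_X,
      Polynomial.eval_pow] at this
    rw [← this]; ring
  rw [← hTe, key]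
  calc _ ≤ ‖y‖ ^ (L + 2) * K₁ + K₂ * (‖y‖ ^ (L + 2) * K₃) := by
        refine (norm_add_le _ _).trans (add_le_add ?_ ?_)
        · rw [norm_mul, norm_pow]
          exact mul_le_mul_of_nonneg_left (hK₁ y hmem) (by positivity)
        · rw [norm_mul]
          exact mul_le_mul (hK₂ y hmem) (hK₃ y hy) (norm_nonneg _)
            ((norm_nonneg _).trans (hK₂ y hmem))
    _ = _ := by ring

/-- Asymptotic expansion of `1 / (exp y - 1)` at the origin, uniformly on the cone
`‖y‖ ≤ c * y.re`. -/
theorem exists_norm_inv_exp_sub_one_sub_le (L : ℕ) {c : ℝ} (hc : 0 < c) :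
    ∃ K : ℝ, ∀ y : ℂ, 0 < y.re → ‖y‖ ≤ c * y.re →
      ‖(exp y - 1)⁻¹ - (∑ k ∈ Finset.range (L + 1),
        ((bernoulli k : ℚ) : ℂ) / (k.factorial : ℂ) * y ^ k) / y‖ ≤ K * ‖y‖ ^ L := by
  obtain ⟨K₁, hK₁⟩ := exists_norm_sum_bernoulli_mul_exp_sub_one_sub_le L
  set b : ℕ → ℂ := fun k ↦ ((bernoulli k : ℚ) : ℂ) / (k.factorial : ℂ) with hb
  set M : ℝ := 2 * c * 2 ^ L + ∑ k ∈ Finset.range (L + 1), ‖b k‖ * 2 ^ (L + 1) with hM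
  have hM0 : 0 ≤ M := by positivity
  refine ⟨2 * |K₁| + M, fun y hy hyc ↦ ?_⟩
  have hy0 : y ≠ 0 := by rintro rfl; simp at hy
  have hyn : 0 < ‖y‖ := norm_pos_iff.2 hy0
  have hE : exp y - 1 ≠ 0 := by
    intro h
    have : ‖exp y‖ = 1 := by rw [sub_eq_zero.1 h]; simp
    rw [norm_exp, Real.exp_eq_one_iff] at this
    exact hy.ne' this
  -- Near the origin `exp y - 1` is comparable to `y`. Away from it no cancellation is needed: the
  -- cone keeps `y.re` away from `0`, and `2 * ‖y‖ ≥ 1` lets each term be absorbed into `‖y‖ ^ L`.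
  rcases le_total ‖y‖ (1 / 2) with hle | hge
  · have h1 := hK₁ y (by linarith)
    have h2 : ‖y‖ / 2 ≤ ‖exp y - 1‖ := by
      have h3 := Complex.norm_exp_sub_one_sub_id_le (x := y) (by linarith)
      have h4 : ‖y‖ ≤ ‖exp y - 1‖ + ‖exp y - 1 - y‖ := by
        calc ‖y‖ = ‖(exp y - 1) - (exp y - 1 - y)‖ := by congr 1; ring
          _ ≤ _ := norm_sub_le _ _
      nlinarith
    have h5 : (exp y - 1)⁻¹ - (∑ k ∈ Finset.range (L + 1), b k * y ^ k) / y =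
        -((∑ k ∈ Finset.range (L + 1), b k * y ^ k) * (exp y - 1) - y) / (y * (exp y - 1)) := by
      field_simp
      ring
    rw [h5, norm_div, norm_neg, norm_mul]
    calc _ ≤ |K₁| * ‖y‖ ^ (L + 2) / (‖y‖ * (‖y‖ / 2)) := by
          refine div_le_div₀ (by positivity) (h1.trans ?_) (by positivity) (by gcongr)
          gcongr
          exact le_abs_self _
      _ = 2 * |K₁| * ‖y‖ ^ L := by
          rw [div_eq_iff (by positivity)]; ring
      _ ≤ _ := by gcongr; linarith
  · have h2y : 1 ≤ 2 * ‖y‖ := by linarith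
    have h1 : (2 * c)⁻¹ ≤ ‖exp y - 1‖ := by
      have h3 : Real.exp y.re - 1 ≤ ‖exp y - 1‖ := by
        have := norm_sub_norm_le (exp y) 1
        rwa [norm_exp, norm_one] at this
      have h4 := Real.add_one_le_exp y.re
      have h5 : (2 * c)⁻¹ ≤ y.re := by
        rw [inv_le_iff_one_le_mul₀' (by positivity)]
        linarith
      linarith
    have h2 : ‖(exp y - 1)⁻¹‖ ≤ 2 * c * 2 ^ L * ‖y‖ ^ L := by
      rw [norm_inv]
      calc ‖exp y - 1‖⁻¹ ≤ 2 * c := inv_le_of_inv_le₀ (by positivity) h1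
        _ ≤ 2 * c * (2 * ‖y‖) ^ L := le_mul_of_one_le_right (by positivity) (one_le_pow₀ h2y)
        _ = _ := by ring
    have h3 : ‖(∑ k ∈ Finset.range (L + 1), b k * y ^ k) / y‖ ≤
        (∑ k ∈ Finset.range (L + 1), ‖b k‖ * 2 ^ (L + 1)) * ‖y‖ ^ L := by
      rw [Finset.sum_div, Finset.sum_mul]
      refine norm_sum_le_of_le _ fun k hk ↦ ?_
      have hk' : k ≤ L + 1 := by grind
      rw [norm_div, norm_mul, norm_pow, div_le_iff₀ hyn, mul_assoc, mul_assoc]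
      gcongr
      calc ‖y‖ ^ k ≤ (2 * ‖y‖) ^ k := by gcongr; linarith
        _ ≤ (2 * ‖y‖) ^ (L + 1) := pow_le_pow_right₀ h2y hk'
        _ = _ := by ring
    calc _ ≤ _ := norm_sub_le _ _
      _ ≤ M * ‖y‖ ^ L := by rw [hM, add_mul]; exact add_le_add h2 h3
      _ ≤ _ := by gcongr; linarith [abs_nonneg K₁]

/-! ### Infinite products and eta inversion -/

/-- The logarithm of `∏ (1 - w * q ^ (n + 1))` as a Lambert series. -/
theorem tprod_one_sub_mul_pow_eq_exp {q w : ℂ} (hq : ‖q‖ < 1) (hw : ‖w‖ ≤ 1) :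
    ∏' n : ℕ, (1 - w * q ^ (n + 1)) =
      exp (-∑' m : ℕ, w ^ (m + 1) / ((m + 1 : ℕ) : ℂ) * (q ^ (m + 1) / (1 - q ^ (m + 1)))) := by
  set a : ℕ → ℕ → ℂ := fun n m ↦ (w * q ^ (n + 1)) ^ (m + 1) / ((m + 1 : ℕ) : ℂ) with ha
  have hr := norm_nonneg q
  have hlt (n : ℕ) : ‖w * q ^ (n + 1)‖ < 1 := by
    rw [norm_mul, norm_pow]
    calc _ ≤ 1 * ‖q‖ ^ (n + 1) := by gcongr
      _ < 1 := by rw [one_mul]; exact pow_lt_one₀ hr hq (Nat.succ_ne_zero n)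
  have hgeom : Summable fun n : ℕ ↦ ‖q‖ ^ n := summable_geometric_of_lt_one hr hq
  have hsum : Summable (Function.uncurry a) := by
    refine Summable.of_norm_bounded (hgeom.mul_of_nonneg hgeom (fun _ ↦ by positivity)
      (fun _ ↦ by positivity)) ?_
    rintro ⟨n, m⟩
    simp only [Function.uncurry, ha, norm_div, norm_pow, norm_mul, norm_natCast]
    have h1 : (1 : ℝ) ≤ ((m + 1 : ℕ) : ℝ) := by exact_mod_cast Nat.succ_pos m
    calc _ ≤ (‖w‖ * ‖q‖ ^ (n + 1)) ^ (m + 1) := div_le_self (by positivity) h1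
      _ ≤ (1 * ‖q‖ ^ (n + 1)) ^ (m + 1) := by gcongr
      _ = ‖q‖ ^ ((n + 1) * (m + 1)) := by rw [one_mul, pow_mul]
      -- Since `(n + 1) * (m + 1) ≥ n + m`, a product of two geometric series dominates the double
      -- series, even for `‖w‖ = 1`.
      _ ≤ ‖q‖ ^ (n + m) := pow_le_pow_of_le_one hr hq.le (by nlinarith)
      _ = _ := pow_add _ _ _
  have hlog (n : ℕ) : ∑' m, a n m = -log (1 - w * q ^ (n + 1)) := by
    have h := (hasSum_nat_add_iff' 1).2 (hasSum_taylorSeries_neg_log (hlt n))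
    simpa [ha] using h.tsum_eq
  have hne (n : ℕ) : 1 - w * q ^ (n + 1) ≠ 0 := by
    intro h
    have := hlt n
    rw [← sub_eq_zero.1 h] at this
    simp at this
  have hcol (m : ℕ) : ∑' n, a n m =
      w ^ (m + 1) / ((m + 1 : ℕ) : ℂ) * (q ^ (m + 1) / (1 - q ^ (m + 1))) := by
    have hqm : ‖q ^ (m + 1)‖ < 1 := by
      rw [norm_pow]; exact pow_lt_one₀ hr hq (Nat.succ_ne_zero m)
    have h := (hasSum_geometric_of_norm_lt_one hqm).mul_left
      (w ^ (m + 1) / ((m + 1 : ℕ) : ℂ) * q ^ (m + 1))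
    rw [div_eq_mul_inv (q ^ (m + 1)), ← mul_assoc, ← h.tsum_eq]
    refine tsum_congr fun n ↦ ?_
    simp only [ha]
    rw [mul_pow, ← pow_mul, ← pow_mul]
    ring
  have hsl : Summable fun n : ℕ ↦ log (1 - w * q ^ (n + 1)) := by
    have h := hsum.prod.neg
    simpa [Function.uncurry, hlog] using h
  rw [← cexp_tsum_eq_tprod hne hsl]
  congr 1
  rw [← tsum_congr hcol, hsum.tsum_comm, tsum_congr hlog, tsum_neg, neg_neg]

/-- The infinite product `∏ (1 - q ^ (n + 1))` is exponentially close to `1`. -/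
theorem exists_tprod_one_sub_pow_eq_exp {q : ℂ} {r : ℝ} (hqr : ‖q‖ ≤ r) (hr : r < 1) :
    ∃ E : ℂ, ‖E‖ ≤ ‖q‖ / (1 - r) ^ 2 ∧ ∏' n : ℕ, (1 - q ^ (n + 1)) = exp E := by
  have hq := hqr.trans_lt hr
  have hq0 := norm_nonneg q
  refine ⟨_, ?_, by simpa using tprod_one_sub_mul_pow_eq_exp hq (w := 1) (by simp)⟩
  rw [norm_neg]
  have hg := ((hasSum_geometric_of_lt_one hq0 hq).mul_left (‖q‖ / (1 - r)))
  refine (tsum_of_norm_bounded hg fun m ↦ ?_).trans ?_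
  · have h1 : (1 : ℝ) ≤ ((m : ℝ) + 1) := by simp
    have h2 : 1 - r ≤ ‖1 - q ^ (m + 1)‖ := by
      have h3 := norm_sub_norm_le 1 (q ^ (m + 1))
      rw [norm_one, norm_pow] at h3
      have h4 : ‖q‖ ^ (m + 1) ≤ ‖q‖ := pow_le_of_le_one hq0 hq.le (Nat.succ_ne_zero m)
      linarith
    have h5 : ‖((m : ℂ) + 1)‖ = (m : ℝ) + 1 := by
      have := norm_natCast (m + 1)
      push_cast at this
      exact this
    simp only [norm_mul, norm_inv, norm_div, norm_pow, h5]
    calc _ ≤ 1 * (‖q‖ ^ (m + 1) / (1 - r)) := by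
          have : 0 < 1 - r := by linarith
          gcongr
          exact inv_le_one_of_one_le₀ h1
      _ = _ := by ring
  · rw [← div_eq_mul_inv, div_div, sq]
    have : 0 < 1 - r := by linarith
    gcongr

open ModularForm in
/-- The inversion formula of the Dedekind eta function in terms of the products
`∏ (1 - q ^ (n + 1))` at `q = exp h` and at `q = exp (4 * π ^ 2 / h)`. -/
theorem tprod_one_sub_exp_pow_inversion {h : ℂ} (hh : h.re < 0) :
    ∏' n : ℕ, (1 - exp (4 * (Real.pi : ℂ) ^ 2 / h) ^ (n + 1)) =
      exp (log (-h / (2 * Real.pi)) / 2) *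
        exp (h / 24 - (Real.pi : ℂ) ^ 2 / (6 * h)) * ∏' n : ℕ, (1 - exp h ^ (n + 1)) := by
  have hpi : (Real.pi : ℂ) ≠ 0 := by exact_mod_cast Real.pi_ne_zero
  have hh0 : h ≠ 0 := by rintro rfl; simp at hh
  -- Chosen so that `exp (2πiτ) = exp h`; `h.re < 0` puts `τ` in the upper half plane.
  set τ : ℂ := I * (-h / (2 * Real.pi)) with hτ
  have hu : -h / (2 * (Real.pi : ℂ)) = ((2 * Real.pi)⁻¹ : ℝ) * (-h) := by
    push_cast; field_simp
  have hure : 0 < (-h / (2 * (Real.pi : ℂ))).re := by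
    rw [hu, re_ofReal_mul]
    have := Real.pi_pos
    have : 0 < (-h).re := by simpa using hh
    positivity
  have hu0 : -h / (2 * (Real.pi : ℂ)) ≠ 0 := by intro h0; simp [h0] at hure
  have hτ0 : τ ≠ 0 := mul_ne_zero I_ne_zero hu0
  have hτm : τ ∈ UpperHalfPlane.upperHalfPlaneSet := by
    show 0 < τ.im
    rw [hτ, I_mul_im]; exact hure
  have key := eta_comp_eq_csqrt_I_inv hτm
  have hlog : log τ = log I + log (-h / (2 * Real.pi)) := by
    rw [hτ]
    refine log_mul I_ne_zero hu0 ?_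
    have h1 := abs_lt.1 (abs_arg_lt_pi_div_two_iff.2 (Or.inl hure))
    rw [arg_I]
    constructor <;> linarith [h1.1, h1.2]
  have e1 : 2 * Real.pi * I * τ = h := by
    rw [hτ]; field_simp; simp
  have e2 : 2 * Real.pi * I * (-1 / τ) = 4 * (Real.pi : ℂ) ^ 2 / h := by
    rw [hτ]; field_simp; norm_num
  have q1 (n : ℕ) : eta_q n τ = exp h ^ (n + 1) := by rw [eta_q_eq_pow, e1]
  have q2 (n : ℕ) : eta_q n (-1 / τ) = exp (4 * (Real.pi : ℂ) ^ 2 / h) ^ (n + 1) := by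
    rw [eta_q_eq_pow, e2]
  simp only [Function.comp, Pi.smul_apply, Pi.mul_apply, smul_eq_mul, ModularForm.eta, q1, q2,
    Function.Periodic.qParam, sqrt_eq_exp hτ0, sqrt_eq_exp I_ne_zero, hlog, e1, e2] at key
  have hne := exp_ne_zero (4 * (Real.pi : ℂ) ^ 2 / h / ((24 : ℝ) : ℂ))
  rw [← mul_right_inj' hne, key, ← exp_neg]
  simp only [← mul_assoc, ← exp_add]
  congr 2
  push_cast
  field_simp
  ring

/-! ### Polylogarithms and the Lambert series -/

open RestrictedProduct

theorem polylog_summand_eq (k m : ℕ) (w : ℂ) :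
    w ^ (m + 1) / ((m + 1 : ℕ) : ℂ) ^ (2 - (k : ℂ)) =
      ((m + 1 : ℕ) : ℂ) ^ k / ((m + 1 : ℕ) : ℂ) ^ 2 * w ^ (m + 1) := by
  have h0 : ((m + 1 : ℕ) : ℂ) ≠ 0 := by exact_mod_cast Nat.succ_ne_zero m
  rw [cpow_sub _ _ h0, cpow_natCast, cpow_ofNat]
  field_simp

theorem summable_succ_pow_mul_geometric (k : ℕ) {r : ℝ} (hr0 : 0 ≤ r) (hr : r < 1) :
    Summable fun m : ℕ ↦ ((m + 1 : ℕ) : ℝ) ^ k * r ^ (m + 1) :=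
  (summable_nat_add_iff (f := fun m : ℕ ↦ (m : ℝ) ^ k * r ^ m) 1).2
    (summable_pow_mul_geometric_of_norm_lt_one k (by rwa [Real.norm_of_nonneg hr0]))

theorem summable_polylog (k : ℕ) {w : ℂ} (hw : ‖w‖ < 1) :
    Summable fun m : ℕ ↦ w ^ (m + 1) / ((m + 1 : ℕ) : ℂ) ^ (2 - (k : ℂ)) := by
  refine Summable.of_norm_bounded
    (summable_succ_pow_mul_geometric k (norm_nonneg w) hw) fun m ↦ ?_
  rw [polylog_summand_eq, norm_mul, norm_div, norm_pow, norm_pow, norm_pow,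
    Complex.norm_natCast]
  have h1 : (1 : ℝ) ≤ ((m + 1 : ℕ) : ℝ) := by exact_mod_cast Nat.succ_pos m
  gcongr
  exact div_le_self (by positivity) (one_le_pow₀ h1)

theorem polylog_two_one : polylog 2 1 = (Real.pi : ℂ) ^ 2 / 6 := by
  have h := zeta_eq_tsum_one_div_nat_add_one_cpow (s := 2) (by norm_num)
  rw [riemannZeta_two] at h
  rw [h, polylog]
  simp

theorem polylog_one {w : ℂ} (hw : ‖w‖ < 1) : polylog 1 w = -log (1 - w) := by
  have h := (hasSum_nat_add_iff' 1).2 (hasSum_taylorSeries_neg_log hw)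
  simpa [polylog] using h.tsum_eq

/-- Expansion of the Lambert series `∑ e ^ (m z) / (m (e ^ (-m z / N) - 1))` as `N → ∞`. -/
theorem exists_norm_lambert_sub_sum_polylog_le (L : ℕ) {δ C : ℝ} (hδ : 0 < δ) (hC : 0 < C) :
    ∃ K : ℝ, ∀ N : ℕ, 1 ≤ N → ∀ z : ℂ, z.re ≤ -δ → ‖z‖ ≤ C →
      ‖∑' m : ℕ, exp z ^ (m + 1) / ((m + 1 : ℕ) : ℂ) *
          (exp (z / N) ^ (m + 1) / (1 - exp (z / N) ^ (m + 1))) -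
        ∑ k ∈ Finset.range (L + 1), ((bernoulli k : ℚ) : ℂ) / (k.factorial : ℂ) *
          ((-(z / N)) ^ k / (-(z / N))) * polylog (2 - (k : ℂ)) (exp z)‖ ≤
        K * ((N : ℝ) ^ L)⁻¹ := by
  obtain ⟨K₀, hK₀⟩ := exists_norm_inv_exp_sub_one_sub_le L (c := C / δ) (by positivity)
  set ρ := Real.exp (-δ) with hρ
  have hρ1 : ρ < 1 := by rw [hρ, Real.exp_lt_one_iff]; linarith
  have hρ0 : 0 ≤ ρ := (Real.exp_pos _).le
  have hs := summable_succ_pow_mul_geometric L hρ0 hρ1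
  refine ⟨|K₀| * C ^ L * ∑' m : ℕ, ((m + 1 : ℕ) : ℝ) ^ L * ρ ^ (m + 1), fun N hN z hz hzC ↦ ?_⟩
  have hNpos : (0 : ℝ) < N := by exact_mod_cast hN
  have hN0 : (N : ℂ) ≠ 0 := by exact_mod_cast hNpos.ne'
  have hz0 : z ≠ 0 := by rintro rfl; simp at hz; linarith
  have hwρ : ‖exp z‖ ≤ ρ := by rw [norm_exp]; exact Real.exp_le_exp.2 hz
  have hw := hwρ.trans_lt hρ1
  set b : ℕ → ℂ := fun k ↦ ((bernoulli k : ℚ) : ℂ) / (k.factorial : ℂ) with hb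
  set h : ℂ := z / N with hh
  have hh0 : h ≠ 0 := div_ne_zero hz0 hN0
  set u : ℕ → ℂ := fun m ↦ exp z ^ (m + 1) / ((m + 1 : ℕ) : ℂ) *
    (exp h ^ (m + 1) / (1 - exp h ^ (m + 1))) with hu
  set v : ℕ → ℕ → ℂ := fun k m ↦ b k * ((-h) ^ k / (-h)) *
    (exp z ^ (m + 1) / ((m + 1 : ℕ) : ℂ) ^ (2 - (k : ℂ))) with hv
  have hvs (k : ℕ) : Summable (v k) := (summable_polylog k hw).mul_left _
  have hvt (k : ℕ) : ∑' m, v k m = b k * ((-h) ^ k / (-h)) * polylog (2 - (k : ℂ)) (exp z) :=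
    tsum_mul_left
  have herr (m : ℕ) : ‖u m - ∑ k ∈ Finset.range (L + 1), v k m‖ ≤
      |K₀| * C ^ L * ((N : ℝ) ^ L)⁻¹ * (((m + 1 : ℕ) : ℝ) ^ L * ρ ^ (m + 1)) := by
    have hm1 : (1 : ℝ) ≤ ((m + 1 : ℕ) : ℝ) := by exact_mod_cast Nat.succ_pos m
    have hmc : ((m + 1 : ℕ) : ℂ) ≠ 0 := by exact_mod_cast Nat.succ_ne_zero m
    -- A positive multiple of `-z`, so the cone constant `C / δ` serves all `m` and `N`.
    set y : ℂ := -(((m + 1 : ℕ) : ℂ) * h) with hy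
    have hyr : y = (((m + 1 : ℕ) : ℝ) / N : ℝ) * (-z) := by
      rw [hy, hh]; push_cast; ring
    have hyre : y.re = ((m + 1 : ℕ) : ℝ) / N * (-z.re) := by
      rw [hyr, re_ofReal_mul, neg_re]
    have hynorm : ‖y‖ = ((m + 1 : ℕ) : ℝ) / N * ‖z‖ := by
      rw [hyr, norm_mul, norm_neg, norm_real, Real.norm_of_nonneg (by positivity)]
    have hzre : 0 < -z.re := by linarith
    have hpos : 0 < y.re := by rw [hyre]; positivity
    have hcone : ‖y‖ ≤ C / δ * y.re := by
      rw [hyre, hynorm, mul_left_comm]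
      gcongr
      calc ‖z‖ ≤ C := hzC
        _ = C / δ * δ := by field_simp
        _ ≤ _ := by gcongr; linarith
    have hyC : ‖y‖ ≤ ((m + 1 : ℕ) : ℝ) / N * C := by rw [hynorm]; gcongr
    have hy0 : y ≠ 0 := by intro h0; simp [h0] at hpos
    have hE : exp h ^ (m + 1) / (1 - exp h ^ (m + 1)) = (exp y - 1)⁻¹ := by
      have : exp y = (exp h ^ (m + 1))⁻¹ := by rw [hy, exp_neg, exp_nat_mul]
      have h0 : exp h ^ (m + 1) ≠ 0 := pow_ne_zero _ (exp_ne_zero h)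
      rw [this, ← inv_inv (exp h ^ (m + 1) / _), inv_div, sub_div, div_self h0, one_div]
    have hvm : ∑ k ∈ Finset.range (L + 1), v k m = exp z ^ (m + 1) / ((m + 1 : ℕ) : ℂ) *
        ((∑ k ∈ Finset.range (L + 1), b k * y ^ k) / y) := by
      rw [Finset.sum_div, Finset.mul_sum]
      refine Finset.sum_congr rfl fun k _ ↦ ?_
      simp only [hv]
      rw [polylog_summand_eq, hy, ← mul_neg, mul_pow]
      field_simp
    simp only [hu]
    rw [hvm, hE, ← mul_sub, norm_mul, norm_div, norm_pow, Complex.norm_natCast]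
    calc _ ≤ ρ ^ (m + 1) * (|K₀| * (((m + 1 : ℕ) : ℝ) / N * C) ^ L) := by
          gcongr
          · exact (div_le_self (by positivity) hm1).trans (by gcongr)
          · refine (hK₀ y hpos hcone).trans ?_
            gcongr
            exact le_abs_self _
      _ = _ := by rw [mul_pow, div_pow]; ring
  have hes := Summable.of_norm_bounded (hs.mul_left (|K₀| * C ^ L * ((N : ℝ) ^ L)⁻¹)) herr
  have hvsum : Summable fun m ↦ ∑ k ∈ Finset.range (L + 1), v k m := summable_sum fun k _ ↦ hvs k
  have hus : Summable u := by simpa using hes.add hvsum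
  have heq : ∑' m, u m - ∑ k ∈ Finset.range (L + 1), b k * ((-h) ^ k / (-h)) *
      polylog (2 - (k : ℂ)) (exp z) = ∑' m, (u m - ∑ k ∈ Finset.range (L + 1), v k m) := by
    rw [hus.tsum_sub hvsum, Summable.tsum_finsetSum fun k _ ↦ hvs k]
    simp_rw [hvt]
  rw [heq]
  refine (tsum_of_norm_bounded (hs.mul_left _).hasSum herr).trans (le_of_eq ?_)
  rw [tsum_mul_left]; ring

/-- The polynomial part of the expansion, written with `p` and `f`. -/
theorem sum_bernoulli_mul_polylog_eq (M N : ℕ) (hN : N ≠ 0) {z : ℂ} (hz : z.re < 0) :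
    ∑ k ∈ Finset.range (M + 1 + 1), ((bernoulli k : ℚ) : ℂ) / (k.factorial : ℂ) *
        ((-(z / N)) ^ k / (-(z / N))) * polylog (2 - (k : ℂ)) (exp z) =
      log (1 - exp z) / 2 - N * p z - (Real.pi : ℂ) ^ 2 / (6 * (z / N)) +
        (if M = 0 then 0 else z / N / 24) -
        ∑ l ∈ Finset.Icc 1 M, f l z / (N : ℂ) ^ l := by
  have hN0 : (N : ℂ) ≠ 0 := by exact_mod_cast hN
  have hz0 : z ≠ 0 := by rintro rfl; simp at hz
  have hw : ‖exp z‖ < 1 := by rw [norm_exp, Real.exp_lt_one_iff]; exact hz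
  have hIcc (g : ℕ → ℂ) : ∑ l ∈ Finset.Icc 1 M, g l = ∑ i ∈ Finset.range M, g (i + 1) := by
    rw [Finset.range_eq_Ico, Finset.sum_Ico_add' g 0 M 1]
    rfl
  have hterm (l : ℕ) : ((bernoulli (l + 1 + 1) : ℚ) : ℂ) / ((l + 1 + 1).factorial : ℂ) *
      ((-(z / N)) ^ (l + 1 + 1) / (-(z / N))) * polylog (2 - ((l + 1 + 1 : ℕ) : ℂ)) (exp z) =
      (if l = 0 then z / N / 24 else 0) - f (l + 1) z / (N : ℂ) ^ (l + 1) := by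
    have h1 : (2 - ((l + 1 + 1 : ℕ) : ℂ)) = 1 - ((l + 1 : ℕ) : ℂ) := by push_cast; ring
    have h2 : (-(z / N)) ^ (l + 1 + 1) / (-(z / N)) = (-(z / N)) ^ (l + 1) := by
      rw [pow_succ, mul_div_cancel_right₀]
      exact neg_ne_zero.2 (div_ne_zero hz0 hN0)
    have h3 : (if l = 0 then z / N / 24 else 0) =
        (if l + 1 = 1 then z / 24 else 0) / (N : ℂ) ^ (l + 1) := by
      rcases eq_or_ne l 0 with rfl | hl
      · simp; ring
      · simp [hl]
    rw [h1, h2, h3, f, add_div, sub_add_cancel_left]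
    -- For even `l + 1` the sign of `(-h) ^ (l + 1)` is wrong, but the Bernoulli number has odd
    -- index at least `3` and vanishes.
    rcases Nat.even_or_odd (l + 1) with he | ho
    · rw [bernoulli_eq_zero_of_odd he.add_one (by omega)]
      simp
    · rw [ho.neg_pow, div_pow]
      ring
  -- The terms `k = 0` and `k = 1` are split off: they give `p` with the `π²` term, and, as `B₁ =
  -- -1/2`, half the logarithm.
  rw [Finset.sum_range_succ', Finset.sum_range_succ', hIcc, Finset.sum_congr rfl fun l _ ↦ hterm l,
    Finset.sum_sub_distrib, Finset.sum_ite_eq']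
  have h1 : polylog (2 - ((0 + 1 : ℕ) : ℂ)) (exp z) = -log (1 - exp z) := by
    rw [← polylog_one hw]; congr 1; norm_num
  rw [h1, p, polylog_two_one]
  rcases eq_or_ne M 0 with rfl | hM
  · simp
    field_simp
    ring
  · simp [hM, Nat.pos_of_ne_zero hM]
    field_simp
    ring

/-! ### Branch of the root, error bounds and assembly -/

/-- Both `-h / (2π)` and `1 - exp z` have positive real part, so their arguments differ by less than
`π` and the principal logarithm of the quotient splits. -/
theorem cpow_half_neg_div_one_sub_exp {z : ℂ} (hz : z.re < 0) {N : ℕ} (hN : N ≠ 0) :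
    (-z / (2 * (Real.pi : ℂ) * (N : ℂ) * (1 - exp z))) ^ (1 / 2 : ℂ) =
      exp (log (-(z / N) / (2 * Real.pi)) / 2 - log (1 - exp z) / 2) := by
  have hw : ‖exp z‖ < 1 := by rw [norm_exp, Real.exp_lt_one_iff]; exact hz
  have hpi := Real.pi_pos
  have hNpos : (0 : ℝ) < N := by exact_mod_cast Nat.pos_of_ne_zero hN
  have hare : 0 < (-(z / N) / (2 * (Real.pi : ℂ))).re := by
    have : -(z / N) / (2 * (Real.pi : ℂ)) = ((N * (2 * Real.pi))⁻¹ : ℝ) * (-z) := by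
      push_cast
      have : (N : ℂ) ≠ 0 := by exact_mod_cast hN
      field_simp
    rw [this, re_ofReal_mul, neg_re]
    have : 0 < -z.re := by linarith
    positivity
  have hbre : 0 < (1 - exp z).re := by
    have := (abs_le.1 (abs_re_le_norm (exp z))).2
    simp only [sub_re, one_re]
    linarith
  have ha0 : -(z / N) / (2 * (Real.pi : ℂ)) ≠ 0 := by intro h0; simp [h0] at hare
  have hb0 : 1 - exp z ≠ 0 := by intro h0; simp [h0] at hbre
  have haa := abs_lt.1 (abs_arg_lt_pi_div_two_iff.2 (Or.inl hare))
  have hba := abs_lt.1 (abs_arg_lt_pi_div_two_iff.2 (Or.inl hbre))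
  have hbpi : (1 - exp z).arg ≠ Real.pi := by linarith [hba.2]
  have hlog : log (-z / (2 * (Real.pi : ℂ) * (N : ℂ) * (1 - exp z))) =
      log (-(z / N) / (2 * Real.pi)) - log (1 - exp z) := by
    rw [sub_eq_add_neg (log _), ← log_inv _ hbpi, ← log_mul ha0 (inv_ne_zero hb0)]
    · congr 1
      field_simp
    · rw [arg_inv, if_neg hbpi]
      constructor <;> linarith [haa.1, haa.2, hba.1, hba.2]
  rw [cpow_def_of_ne_zero, hlog]
  · congr 1; ring
  · have : (N : ℂ) ≠ 0 := by exact_mod_cast hN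
    have hz0 : z ≠ 0 := by rintro rfl; simp at hz
    have : (Real.pi : ℂ) ≠ 0 := by exact_mod_cast hpi.ne'
    simp_all

theorem qProd_mul_tprod {q : ℂ} (hq : ‖q‖ < 1) (N : ℕ) :
    qProd q N * ∏' n : ℕ, (1 - q ^ N * q ^ (n + 1)) = ∏' n : ℕ, (1 - q ^ (n + 1)) := by
  have hm : Multipliable fun n : ℕ ↦ 1 - q ^ (n + N + 1) := by
    refine (multipliable_one_add_of_summable (f := fun n ↦ -q ^ (n + N + 1)) ?_).congr
      fun n ↦ by ring
    have := (summable_nat_add_iff (N + 1)).2 (summable_geometric_of_lt_one (norm_nonneg q) hq)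
    simpa [add_assoc] using this
  rw [← hm.prod_mul_tprod_nat_mul' (f := fun n ↦ 1 - q ^ (n + 1)), qProd,
    Finset.range_eq_Ico, Finset.prod_Ico_add' (fun j ↦ 1 - q ^ j) 0 N 1]
  congr 1
  exact tprod_congr fun n ↦ by ring

theorem exists_pow_le_mul_inv_pow (L : ℕ) {r : ℝ} (hr0 : 0 ≤ r) (hr : r < 1) :
    ∃ K : ℝ, ∀ N : ℕ, 1 ≤ N → r ^ N ≤ K * ((N : ℝ) ^ L)⁻¹ := by
  obtain ⟨K, hK⟩ := (tendsto_pow_const_mul_const_pow_of_abs_lt_one L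
    (by rwa [abs_of_nonneg hr0])).bddAbove_range
  refine ⟨K, fun N hN ↦ ?_⟩
  have hN' : (0 : ℝ) < N := by exact_mod_cast hN
  rw [← div_eq_mul_inv, le_div_iff₀ (by positivity), mul_comm]
  exact hK ⟨N, rfl⟩

/-- The real part of `1 / z` is `z.re / ‖z‖ ^ 2 ≤ -δ / C ^ 2`; this is what makes the dual nome
exponentially small in `N`. -/
theorem norm_exp_four_pi_sq_div_le {δ C : ℝ} (hδ : 0 < δ) {z : ℂ}
    (hz : z.re ≤ -δ) (hzC : ‖z‖ ≤ C) (N : ℕ) :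
    ‖exp (4 * (Real.pi : ℂ) ^ 2 / (z / N))‖ ≤ Real.exp (-(4 * Real.pi ^ 2 * δ / C ^ 2)) ^ N := by
  have hz0 : z ≠ 0 := by rintro rfl; simp at hz; linarith
  have hzn : 0 < ‖z‖ := norm_pos_iff.2 hz0
  rw [norm_exp, ← Real.exp_nat_mul]
  apply Real.exp_le_exp.2
  have h1 : 4 * (Real.pi : ℂ) ^ 2 / (z / N) = ((N * (4 * Real.pi ^ 2) : ℝ) : ℂ) * z⁻¹ := by
    rw [div_div_eq_mul_div]; push_cast; ring
  have h2 : z.re / ‖z‖ ^ 2 ≤ -(δ / C ^ 2) := by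
    rw [← neg_le_neg_iff, neg_neg, ← neg_div]
    exact div_le_div₀ (by linarith) (by linarith) (by positivity) (by gcongr)
  rw [h1, re_ofReal_mul, inv_re, normSq_eq_norm_sq]
  calc _ ≤ N * (4 * Real.pi ^ 2) * -(δ / C ^ 2) := by gcongr
    _ = _ := by ring

theorem theorem2p1 (L : ℕ) (hL : 1 ≤ L) (δ C : ℝ) (hδ : 0 < δ) :
    ∃ K : ℝ, ∀ N : ℕ, 1 ≤ N → ∀ z : ℂ, z.re ≤ -δ → ‖z‖ ≤ C →
      ∃ E : ℂ, ‖E‖ ≤ K * ((N : ℝ) ^ L)⁻¹ ∧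
        1 / RestrictedProduct.qProd (Complex.exp (z / (N : ℂ))) N =
          (-z / (2 * (Real.pi : ℂ) * (N : ℂ) * (1 - Complex.exp z))) ^ (1 / 2 : ℂ) *
            Complex.exp
              ((N : ℂ) * RestrictedProduct.p z +
                ∑ l ∈ Finset.Icc 1 (L - 1), RestrictedProduct.f l z / (N : ℂ) ^ l + E) := by
  rcases le_or_gt C 0 with hC | hC
  · refine ⟨0, fun N _ z hz hzC ↦ ?_⟩
    have : z = 0 := norm_le_zero_iff.1 (hzC.trans hC)
    simp only [this, zero_re] at hz
    linarith
  obtain ⟨M, rfl⟩ : ∃ M, L = M + 1 := ⟨L - 1, by omega⟩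
  obtain ⟨K₁, hK₁⟩ := exists_norm_lambert_sub_sum_polylog_le (M + 1) hδ hC
  set r := Real.exp (-(4 * Real.pi ^ 2 * δ / C ^ 2)) with hr
  have hr0 : 0 ≤ r := (Real.exp_pos _).le
  have hr1 : r < 1 := by
    rw [hr, Real.exp_lt_one_iff, neg_lt_zero]
    have := Real.pi_pos
    positivity
  obtain ⟨K₂, hK₂⟩ := exists_pow_le_mul_inv_pow (M + 1) hr0 hr1
  -- Three errors: the Lambert remainder, the dual product, and `z / (24 N)` when `L = 1`.
  refine ⟨K₁ + K₂ / (1 - r) ^ 2 + C, fun N hN z hz hzC ↦ ?_⟩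
  have hNne : N ≠ 0 := by omega
  have hNpos : (0 : ℝ) < N := by exact_mod_cast hN
  have hN0 : (N : ℂ) ≠ 0 := by exact_mod_cast hNne
  have hz' : z.re < 0 := by linarith
  have hw : ‖exp z‖ ≤ 1 := by rw [norm_exp, Real.exp_le_one_iff]; exact hz'.le
  have hhre : (z / (N : ℂ)).re < 0 := by
    rw [div_natCast_re]; exact div_neg_of_neg_of_pos hz' hNpos
  have hq : ‖exp (z / N)‖ < 1 := by rwa [norm_exp, Real.exp_lt_one_iff]
  have hqN : exp (z / N) ^ N = exp z := by
    rw [← exp_nat_mul]; congr 1; field_simp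
  have hdual := norm_exp_four_pi_sq_div_le hδ hz hzC N
  obtain ⟨E₁, hE₁, hE₁'⟩ := exists_tprod_one_sub_pow_eq_exp
    (hdual.trans (pow_le_of_le_one hr0 hr1.le hNne)) hr1
  have hprod := qProd_mul_tprod hq N
  rw [hqN, tprod_one_sub_mul_pow_eq_exp hq hw] at hprod
  have hinv := tprod_one_sub_exp_pow_inversion hhre
  rw [hE₁', ← hprod] at hinv
  have hexpand := hK₁ N hN z hz hzC
  rw [sum_bernoulli_mul_polylog_eq M N hNne hz'] at hexpand
  set S := ∑' m : ℕ, exp z ^ (m + 1) / ((m + 1 : ℕ) : ℂ) *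
    (exp (z / N) ^ (m + 1) / (1 - exp (z / N) ^ (m + 1))) with hS
  set F := ∑ l ∈ Finset.Icc 1 M, f l z / (N : ℂ) ^ l with hF
  -- The eta term `h / 24` belongs to `f 1`; for `M = 0` the sum is empty, so it must go into `E`.
  set c : ℂ := if M = 0 then 0 else z / N / 24 with hc
  refine ⟨-(S - (log (1 - exp z) / 2 - N * p z - (Real.pi : ℂ) ^ 2 / (6 * (z / N)) + c - F)) -
    E₁ + (z / N / 24 - c), ?_, ?_⟩
  · have hE₁b : ‖E₁‖ ≤ K₂ / (1 - r) ^ 2 * ((N : ℝ) ^ (M + 1))⁻¹ := by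
      rw [div_mul_eq_mul_div]
      have : 0 < 1 - r := by linarith
      exact hE₁.trans (by gcongr; exact hdual.trans (hK₂ N hN))
    have hcb : ‖z / N / 24 - c‖ ≤ C * ((N : ℝ) ^ (M + 1))⁻¹ := by
      rcases eq_or_ne M 0 with rfl | hM
      · simp only [hc, if_true, sub_zero, norm_div, Complex.norm_natCast, zero_add, pow_one]
        rw [← div_eq_mul_inv]
        have h24 : (1 : ℝ) ≤ ‖(24 : ℂ)‖ := by norm_num
        exact (div_le_self (by positivity) h24).trans (by gcongr)
      · simp only [hc, hM, if_false, sub_self, norm_zero]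
        positivity
    rw [add_mul, add_mul]
    refine (norm_add_le _ _).trans (add_le_add ((norm_sub_le _ _).trans (add_le_add ?_ hE₁b)) hcb)
    rwa [norm_neg]
  · have hQ : qProd (exp (z / N)) N ≠ 0 := by
      intro h0
      rw [h0] at hinv
      simp at hinv
    rw [cpow_half_neg_div_one_sub_exp hz' hNne, ← exp_add, one_div]
    refine inv_eq_of_mul_eq_one_right (mul_left_cancel₀ (exp_ne_zero E₁) ?_)
    rw [mul_one]
    conv_rhs => rw [hinv]
    rw [mul_left_comm, ← exp_add, mul_comm (qProd _ _) (exp (-S)), ← mul_assoc, ← exp_add,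
      ← exp_add, mul_comm (exp _)]
    congr 2
    simp only [Nat.add_sub_cancel]
    rw [← hF]
    ring
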